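/- Let $K$ be a field and let $G$ be a finite simple bipartite graph without isolated vertices, with vertex set $V(G)$ and edge set $E(G)$. Let $S=K[x_v : v\in V(G)]$ and let $I(G)=(x_ux_v : \{u,v\}\in E(G))\subset S$ be the edge ideal of $G$. Denote by $\operatorname{depth} S/I(G)$ the maximal length of an $S/I(G)$-regular sequence contained in the graded maximal ideal $\mathfrak m=(x_v : v\in V(G))$ of $S$. Then $G$ is a complete bipartite graph (that is, $G\cong K_{m,n}$ for some $m,n\geq 1$) if and only if $\operatorname{depth} S/I(G)=1$. -/

import Mathlib

/-- The depth of the `R`-module `M` with respect to the ideal `I`: the supremum of the lengths of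
the `M`-regular sequences consisting of elements of `I`. -/
noncomputable def depthIn {R : Type*} [CommRing R] (I : Ideal R)
    (M : Type*) [AddCommGroup M] [Module R M] : ℕ∞ :=
  ⨆ (rs : List R) (_ : RingTheory.Sequence.IsRegular M rs ∧ ∀ r ∈ rs, r ∈ I), (rs.length : ℕ∞)

/-- The edge ideal of `G` in `K[x_v : v ∈ V]`, generated by the monomials `x_u x_v` for the edges
`{u, v}` of `G`. -/
noncomputable def SimpleGraph.edgeIdeal {V : Type*} (G : SimpleGraph V) (K : Type*) [Field K] :
    Ideal (MvPolynomial V K) :=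
  Ideal.span {p | ∃ u v : V, G.Adj u v ∧ p = MvPolynomial.X u * MvPolynomial.X v}

/-- `depth S/I` for an ideal `I` of the polynomial ring `S = K[x_v : v ∈ V]`, taken with respect to
the graded maximal ideal generated by the variables. -/
noncomputable def depthQuotient {V K : Type*} [Field K] (I : Ideal (MvPolynomial V K)) : ℕ∞ :=
  depthIn (MvPolynomial.idealOfVars V K) (MvPolynomial V K ⧸ I)

/-- A graph is complete bipartite if it is isomorphic to some `K_{m,n}` with `m, n ≥ 1`. -/
def SimpleGraph.IsCompleteBipartite {V : Type*} (G : SimpleGraph V) : Prop :=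
  ∃ m n : ℕ, 1 ≤ m ∧ 1 ≤ n ∧ Nonempty (G ≃g completeBipartiteGraph (Fin m) (Fin n))

/-! Write `m` for the ideal of the variables. Since `I(G)` is squarefree, `m` kills no nonzero
element of `S/I(G)`, so the depth is at least 1. If `G` is complete bipartite with classes `A`,
`Aᶜ`, then `P = (X_A)` and `Q = (X_{Aᶜ})` are primes with `PQ ≤ I(G) ≤ P ∩ Q` and `P + Q = m`;
modulo any nonzerodivisor in `m` this yields a nonzero element killed by `m`, so `depthIn_le_one`
applies. If `G` is bipartite but not complete, the color classes are cliques of the complement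
joined by a missing edge, so the complement is connected. This kills the first Koszul cohomology
(`SimpleGraph.exists_sub_X_mul_mem_edgeIdeal`), and `two_le_depthIn` gives depth at least 2. -/

open RingTheory.Sequence MvPolynomial

/-- Prime avoidance: an ideal which kills no nonzero element of `M` contains a nonzerodivisor
on `M`. -/
theorem exists_isSMulRegular_of_forall_smul_eq_zero {R M : Type*} [CommRing R]
    [IsNoetherianRing R] [AddCommGroup M] [Module R M] [Module.Finite R M] (I : Ideal R)
    (h : ∀ x : M, (∀ r ∈ I, r • x = 0) → x = 0) : ∃ r ∈ I, IsSMulRegular M r := by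
  by_contra! hI
  have hsub : (I : Set R) ⊆ ⋃ p ∈ associatedPrimes R M, (id p : Ideal R) := by
    simp only [id]
    rw [biUnion_associatedPrimes_eq_zero_divisors]
    intro r hr
    have := hI r hr
    rw [isSMulRegular_iff_right_eq_zero_of_smul] at this
    push Not at this
    obtain ⟨x, hx, hx0⟩ := this
    exact ⟨x, hx0, hx⟩
  obtain ⟨p, hp, hle⟩ := (Ideal.subset_union_prime_finite (associatedPrimes.finite R M) 0 0
    fun _ h _ _ ↦ h.isPrime).1 hsub
  obtain ⟨hprime, x, rfl⟩ := isAssociatedPrime_iff.1 hp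
  have hx : x = 0 := h x fun r hr ↦ by simpa [Submodule.mem_colon_singleton] using hle hr
  exact hprime.ne_top (by simp [hx])

/-! ### Depth bounds for cyclic modules `R/J`. -/

section Quotient

variable {R : Type*} [CommRing R] {J m : Ideal R}

open Pointwise in
theorem mk_mem_smul_top_iff {f h : R} :
    (Submodule.Quotient.mk h : R ⧸ J) ∈ (f • (⊤ : Submodule R (R ⧸ J))) ↔
      ∃ a, h - f * a ∈ J := by
  rw [Submodule.mem_smul_pointwise_iff_exists]
  constructor
  · rintro ⟨b, -, hb⟩
    obtain ⟨a, rfl⟩ := Submodule.Quotient.mk_surjective _ b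
    refine ⟨a, ?_⟩
    rw [← Submodule.Quotient.mk_smul, eq_comm, Submodule.Quotient.eq] at hb
    simpa using hb
  · rintro ⟨a, ha⟩
    refine ⟨Submodule.Quotient.mk a, trivial, ?_⟩
    rw [← Submodule.Quotient.mk_smul, eq_comm, Submodule.Quotient.eq]
    simpa using ha

theorem isRegular_quotient_of_mem (hm : m ≠ ⊤) (hJ : J ≤ m) {rs : List R}
    (hrs : IsWeaklyRegular (R ⧸ J) rs) (hmem : ∀ r ∈ rs, r ∈ m) : IsRegular (R ⧸ J) rs := by
  refine ⟨hrs, fun htop ↦ hm ?_⟩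
  have hle : Ideal.ofList rs • (⊤ : Submodule R (R ⧸ J)) ≤ Submodule.map J.mkQ m := by
    refine Submodule.smul_le.2 fun r hr x _ ↦ ?_
    obtain ⟨a, rfl⟩ := Submodule.mkQ_surjective _ x
    have hr' : r ∈ m := (Ideal.span_le.2 hmem : Ideal.ofList rs ≤ m) hr
    exact ⟨r * a, m.mul_mem_right a hr', by rw [← smul_eq_mul, map_smul]⟩
  rw [← htop] at hle
  obtain ⟨a, ha, h1⟩ := hle (Submodule.mem_top (x := J.mkQ 1))
  have : a - 1 ∈ J := (Submodule.Quotient.eq J).1 h1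
  rw [Ideal.eq_top_iff_one]
  simpa using m.sub_mem ha (hJ this)

theorem one_le_depthIn [IsNoetherianRing R] (hm : m ≠ ⊤) (hJ : J ≤ m)
    (h0 : ∀ h, (∀ r ∈ m, r * h ∈ J) → h ∈ J) : 1 ≤ depthIn m (R ⧸ J) := by
  obtain ⟨f, hf, hreg⟩ := exists_isSMulRegular_of_forall_smul_eq_zero (M := R ⧸ J) m <| by
    intro x hx
    obtain ⟨h, rfl⟩ := Submodule.Quotient.mk_surjective _ x
    refine (Submodule.Quotient.mk_eq_zero _).2 (h0 h fun r hr ↦ ?_)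
    exact (Submodule.Quotient.mk_eq_zero _).1 (hx r hr)
  refine le_iSup₂_of_le [f] ⟨isRegular_quotient_of_mem hm hJ ?_ ?_, ?_⟩ (by simp)
  · simpa using hreg
  all_goals simpa using hf

/-- `depth R/J ≥ 2` if the zeroth and the first Koszul-type cohomology of `R/J` vanish. -/
theorem two_le_depthIn [IsNoetherianRing R] {ι : Type*} (x : ι → R)
    (hm : Ideal.span (Set.range x) ≠ ⊤) (hJ : J ≤ Ideal.span (Set.range x))
    (h0 : ∀ h, (∀ i, x i * h ∈ J) → h ∈ J)
    (h1 : ∀ c : ι → R, (∀ i j, x i * c j - x j * c i ∈ J) → ∃ d, ∀ i, c i - x i * d ∈ J) :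
    2 ≤ depthIn (Ideal.span (Set.range x)) (R ⧸ J) := by
  set m := Ideal.span (Set.range x) with hmdef
  have hx (i) : x i ∈ m := Ideal.subset_span ⟨i, rfl⟩
  obtain ⟨f, hf, hreg⟩ := exists_isSMulRegular_of_forall_smul_eq_zero (M := R ⧸ J) m <| by
    intro y hy
    obtain ⟨h, rfl⟩ := Submodule.Quotient.mk_surjective _ y
    refine (Submodule.Quotient.mk_eq_zero _).2 (h0 h fun i ↦ ?_)
    exact (Submodule.Quotient.mk_eq_zero _).1 (hy _ (hx i))
  have hfJ (a) (ha : f * a ∈ J) : a ∈ J := mem_of_isSMulRegular_quotient_of_smul_mem hreg ha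
  obtain ⟨g, hg, hreg'⟩ :=
      exists_isSMulRegular_of_forall_smul_eq_zero (M := QuotSMulTop f (R ⧸ J)) m <| by
    intro y hy
    obtain ⟨y, rfl⟩ := Submodule.Quotient.mk_surjective _ y
    obtain ⟨h, rfl⟩ := Submodule.Quotient.mk_surjective _ y
    refine (Submodule.Quotient.mk_eq_zero _).2 ?_
    have hc (i) : ∃ a, x i * h - f * a ∈ J :=
      mk_mem_smul_top_iff.1 ((Submodule.Quotient.mk_eq_zero _).1 (hy _ (hx i)))
    choose c hc using hc
    -- Cancelling `f` makes `c` a Koszul cocycle; if `d` bounds it, every `x i` kills `h - f * d`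
    -- modulo `J`.
    obtain ⟨d, hd⟩ := h1 c fun i j ↦ hfJ _ <| by
      convert J.sub_mem (J.mul_mem_left (x j) (hc i)) (J.mul_mem_left (x i) (hc j)) using 1
      ring
    refine mk_mem_smul_top_iff.2 ⟨d, h0 _ fun i ↦ ?_⟩
    convert J.add_mem (hc i) (J.mul_mem_left f (hd i)) using 1
    ring
  refine le_iSup₂_of_le [f, g] ⟨isRegular_quotient_of_mem hm hJ ?_ ?_, ?_⟩ (by simp)
  · simpa [isWeaklyRegular_cons_iff] using ⟨hreg, hreg'⟩
  all_goals simpa using ⟨hf, hg⟩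

/-- `depth R/J ≤ 1` if for every nonzerodivisor `f ∈ m` on `R/J` some element outside `J + (f)` is
multiplied by `m` into `J + (f)`. -/
theorem depthIn_le_one
    (h : ∀ f ∈ m, (∀ a, f * a ∈ J → a ∈ J) →
      ∃ s, (∀ a, s - f * a ∉ J) ∧ ∀ g ∈ m, ∃ a, g * s - f * a ∈ J) :
    depthIn m (R ⧸ J) ≤ 1 := by
  refine iSup₂_le fun rs ⟨hreg, hmem⟩ ↦ ?_
  match rs with
  | [] => simp
  | [f] => simp
  | f :: g :: rs =>
    have hw := hreg.toIsWeaklyRegular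
    rw [isWeaklyRegular_cons_iff, isWeaklyRegular_cons_iff] at hw
    obtain ⟨hf, hg, -⟩ := hw
    obtain ⟨s, hs, hgs⟩ := h f (hmem f (by simp))
      fun a ha ↦ mem_of_isSMulRegular_quotient_of_smul_mem hf ha
    obtain ⟨a, ha⟩ := mk_mem_smul_top_iff.1 (mem_of_isSMulRegular_quotient_of_smul_mem hg
      (x := Submodule.Quotient.mk s) (mk_mem_smul_top_iff.2 (hgs g (hmem g (by simp)))))
    exact absurd ha (hs a)

end Quotient

/-! ### Edge ideals coefficient by coefficient. -/

section Monomials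

variable {V K : Type*} [Field K]

theorem idealOfVars_ne_top : idealOfVars V K ≠ ⊤ := by
  intro h
  have hle : idealOfVars V K ≤ RingHom.ker (constantCoeff (σ := V) (R := K)) := by
    rw [idealOfVars, Ideal.span_le]
    rintro _ ⟨v, rfl⟩
    simp [RingHom.mem_ker]
  simpa [RingHom.mem_ker] using hle (h ▸ Submodule.mem_top : (1 : MvPolynomial V K) ∈ _)

theorem exists_coeff_eq {φ : (V →₀ ℕ) → K} (hφ : φ.support.Finite) :
    ∃ d : MvPolynomial V K, ∀ γ, coeff γ d = φ γ := by
  classical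
  refine ⟨∑ γ ∈ hφ.toFinset, monomial γ (φ γ), fun γ ↦ ?_⟩
  simp only [coeff_sum, coeff_monomial]
  simp +contextual [eq_comm]

variable (G : SimpleGraph V)

/-- The monomial with exponent `γ` is supported on an independent set of `G`. -/
def SimpleGraph.IsIndepExponent (γ : V →₀ ℕ) : Prop :=
  ∀ u v, G.Adj u v → γ u ≠ 0 → γ v = 0

variable {G}

/-- A monomial lies outside this monomial ideal exactly when its support contains no edge. -/
theorem SimpleGraph.mem_edgeIdeal_iff {p : MvPolynomial V K} :
    p ∈ G.edgeIdeal K ↔ ∀ γ, G.IsIndepExponent γ → coeff γ p = 0 := by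
  have : {p : MvPolynomial V K | ∃ u v : V, G.Adj u v ∧ p = X u * X v} =
      (fun s ↦ monomial s (1 : K)) ''
        {s | ∃ u v, G.Adj u v ∧ s = Finsupp.single u 1 + Finsupp.single v 1} := by
    ext p
    simp only [Set.mem_ofPred_eq, Set.mem_image, X, monomial_mul, one_mul]
    grind
  rw [SimpleGraph.edgeIdeal, this, mem_ideal_span_monomial_image]
  refine forall_congr' fun γ ↦ ?_
  rw [mem_support_iff, ← not_imp_not (b := G.IsIndepExponent γ), ← ne_eq]
  refine imp_congr_right fun _ ↦ ?_
  simp only [SimpleGraph.IsIndepExponent]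
  push Not
  constructor
  · rintro ⟨_, ⟨u, v, huv, rfl⟩, hle⟩
    refine ⟨u, v, huv, ?_, ?_⟩
    · have := hle u
      simp at this
      lia
    · have := hle v
      simp at this
      lia
  · rintro ⟨u, v, huv, hu, hv⟩
    refine ⟨_, ⟨u, v, huv, rfl⟩, fun w ↦ ?_⟩
    classical
    have := huv.ne
    simp only [Finsupp.add_apply, Finsupp.single_apply]
    grind

theorem SimpleGraph.edgeIdeal_le_idealOfVars : G.edgeIdeal K ≤ idealOfVars V K := by
  rw [SimpleGraph.edgeIdeal, Ideal.span_le]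
  rintro _ ⟨u, v, -, rfl⟩
  exact Ideal.mul_mem_right _ _ (Ideal.subset_span ⟨u, rfl⟩)

theorem SimpleGraph.IsIndepExponent.add_single {γ : V →₀ ℕ} (h : G.IsIndepExponent γ) {u : V}
    (hu : γ u ≠ 0) : G.IsIndepExponent (Finsupp.single u 1 + γ) := by
  classical
  intro v w hvw
  have h1 := h v w hvw
  have h2 := h w v hvw.symm
  simp only [Finsupp.add_apply, Finsupp.single_apply]
  have := hvw.ne
  grind

theorem SimpleGraph.isIndepExponent_single (u : V) :
    G.IsIndepExponent (Finsupp.single u 1) := by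
  classical
  intro v w hvw
  have := hvw.ne
  simp only [Finsupp.single_apply]
  grind

theorem SimpleGraph.isIndepExponent_single_add_single {u v : V} (h : ¬ G.Adj u v) :
    G.IsIndepExponent (Finsupp.single u 1 + Finsupp.single v 1) := by
  classical
  intro a b hab
  have := hab.ne
  have := hab.symm
  simp only [Finsupp.add_apply, Finsupp.single_apply]
  grind

theorem SimpleGraph.mem_edgeIdeal_of_forall_X_mul_mem [Nonempty V] {h : MvPolynomial V K}
    (hh : ∀ v, X v * h ∈ G.edgeIdeal K) : h ∈ G.edgeIdeal K := by
  rw [SimpleGraph.mem_edgeIdeal_iff]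
  intro γ hγ
  obtain ⟨u, hu⟩ : ∃ u, G.IsIndepExponent (Finsupp.single u 1 + γ) := by
    by_cases h0 : γ = 0
    · subst h0
      exact ⟨Classical.arbitrary V, by simpa using G.isIndepExponent_single _⟩
    · obtain ⟨u, hu⟩ := Finsupp.ne_iff.1 h0
      exact ⟨u, hγ.add_single hu⟩
  simpa using SimpleGraph.mem_edgeIdeal_iff.1 (hh u) _ hu

/-- Exactness of the Koszul complex of the variables on `S/I(G)` in degree one, when the complement
of `G` is connected. -/
theorem SimpleGraph.exists_sub_X_mul_mem_edgeIdeal [Finite V] [Nontrivial V]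
    (hconn : ∀ k : V → K, (∀ u v, ¬ G.Adj u v → k u = k v) → ∀ u v, k u = k v)
    (c : V → MvPolynomial V K) (hc : ∀ u v, X u * c v - X v * c u ∈ G.edgeIdeal K) :
    ∃ d, ∀ v, c v - X v * d ∈ G.edgeIdeal K := by
  classical
  simp only [SimpleGraph.mem_edgeIdeal_iff, coeff_sub, sub_eq_zero] at hc ⊢
  -- Modulo the ideal, `c v` is divisible by `X v`; by `heq` below, the quotients `c v / X v` agree
  -- where they can be compared.
  have hzero {γ : V →₀ ℕ} {u v : V} (huv : u ≠ v) (hv : γ v = 0)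
      (hi : G.IsIndepExponent (Finsupp.single u 1 + γ)) : coeff γ (c v) = 0 := by
    have := hc u v _ hi
    rw [coeff_X_mul, coeff_X_mul', if_neg] at this
    · exact this
    · simp [hv, huv]
  have heq {γ : V →₀ ℕ} {u v : V}
      (hi : G.IsIndepExponent (Finsupp.single u 1 + (Finsupp.single v 1 + γ))) :
      coeff (Finsupp.single v 1 + γ) (c v) = coeff (Finsupp.single u 1 + γ) (c u) := by
    have := hc u v _ hi
    rwa [coeff_X_mul, add_left_comm, coeff_X_mul] at this
  have hw (γ : V →₀ ℕ) : ∃ w, γ ≠ 0 → γ w ≠ 0 := by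
    by_cases h0 : γ = 0
    · exact ⟨Classical.arbitrary V, fun h ↦ absurd h0 h⟩
    · obtain ⟨u, hu⟩ := Finsupp.ne_iff.1 h0
      exact ⟨u, fun _ ↦ hu⟩
  choose w hw using hw
  -- The coefficient of `d` at `γ` is read off from `c w / X w`, with `w` in the support of `γ` when
  -- `γ ≠ 0`.
  obtain ⟨d, hd⟩ := exists_coeff_eq
      (φ := fun γ ↦ coeff (Finsupp.single (w γ) 1 + γ) (c (w γ))) <| by
    refine (Set.finite_iUnion fun v ↦ ((c v).support.finite_toSet.preimage
      (add_right_injective (Finsupp.single v 1)).injOn)).subset fun γ hγ ↦ ?_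
    simpa using ⟨w γ, hγ⟩
  refine ⟨d, fun v δ hδ ↦ ?_⟩
  rw [coeff_X_mul']
  split_ifs with hv
  · obtain ⟨γ, rfl⟩ : ∃ γ, δ = Finsupp.single v 1 + γ := by
      refine le_iff_exists_add.1 ?_
      simpa [Nat.one_le_iff_ne_zero] using hv
    rw [add_tsub_cancel_left, hd]
    -- Only at `γ = 0` can the choice of `w` matter: there `heq` compares nonadjacent vertices only,
    -- and `hconn` links the rest.
    by_cases h0 : γ = 0
    · subst h0
      have := hconn (fun v ↦ coeff (Finsupp.single v 1) (c v)) fun u v huv ↦ by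
        have := heq (γ := 0) (u := v) (v := u) <| by
          simpa using G.isIndepExponent_single_add_single fun h ↦ huv h.symm
        simpa using this
      simpa using this v (w 0)
    · exact heq (hδ.add_single (by simp [hw γ h0]))
  · simp only [Finsupp.mem_support_iff, not_not] at hv
    by_cases h0 : δ = 0
    · subst h0
      obtain ⟨u, hu⟩ := exists_ne v
      exact hzero hu rfl (by simpa using G.isIndepExponent_single u)
    · refine hzero (u := w δ) ?_ hv (hδ.add_single (hw δ h0))
      rintro rfl
      exact hw δ h0 hv

theorem SimpleGraph.one_le_depthQuotient_edgeIdeal [Finite V] [Nonempty V] :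
    1 ≤ depthQuotient (G.edgeIdeal K) :=
  one_le_depthIn idealOfVars_ne_top SimpleGraph.edgeIdeal_le_idealOfVars fun _ hh ↦
    SimpleGraph.mem_edgeIdeal_of_forall_X_mul_mem fun v ↦ hh _ (Ideal.subset_span ⟨v, rfl⟩)

theorem SimpleGraph.two_le_depthQuotient_edgeIdeal [Finite V] [Nontrivial V]
    (hconn : ∀ k : V → K, (∀ u v, ¬ G.Adj u v → k u = k v) → ∀ u v, k u = k v) :
    2 ≤ depthQuotient (G.edgeIdeal K) :=
  two_le_depthIn X idealOfVars_ne_top SimpleGraph.edgeIdeal_le_idealOfVars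
    (fun _ ↦ SimpleGraph.mem_edgeIdeal_of_forall_X_mul_mem)
    (SimpleGraph.exists_sub_X_mul_mem_edgeIdeal hconn)

end Monomials

/-! ### Complete bipartite graphs: the upper bound. -/

section CompleteBipartite

variable {V K : Type*} [Field K] {G : SimpleGraph V}

theorem SimpleGraph.isCompleteBipartite_iff [Finite V] :
    G.IsCompleteBipartite ↔
      ∃ A : Set V, A.Nonempty ∧ Aᶜ.Nonempty ∧ ∀ u v, G.Adj u v ↔ (u ∈ A ↔ v ∉ A) := by
  constructor
  · rintro ⟨m, n, hm, hn, ⟨e⟩⟩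
    refine ⟨{v | (e v).isLeft}, ⟨e.symm (.inl ⟨0, hm⟩), by simp⟩,
      ⟨e.symm (.inr ⟨0, hn⟩), by simp⟩, fun u v ↦ ?_⟩
    rw [← e.map_adj_iff]
    rcases hu : e u with a | a <;> rcases hv : e v with b | b <;> simp [hu, hv]
  · rintro ⟨A, hA, hA', h⟩
    classical
    have := hA.to_subtype
    have := hA'.to_subtype
    refine ⟨Nat.card A, Nat.card (Aᶜ : Set V), Nat.card_pos, Nat.card_pos, ⟨?_⟩⟩
    refine SimpleGraph.Iso.symm ((SimpleGraph.completeBipartiteGraphCongr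
      (Finite.equivFin A).symm (Finite.equivFin (Aᶜ : Set V)).symm).trans
      ⟨Equiv.Set.sumCompl A, ?_⟩)
    rintro (⟨a, ha⟩ | ⟨a, ha⟩) (⟨b, hb⟩ | ⟨b, hb⟩) <;>
      simp [h, ha, hb] <;> grind

/-- The substitution killing the variables in `A`. -/
noncomputable def killVars (K : Type*) [Field K] (A : Set V) :
    MvPolynomial V K →ₐ[K] MvPolynomial V K :=
  open Classical in aeval fun v ↦ if v ∈ A then 0 else X v

/-- The substitution is the identity modulo the variables in `A`. A kernel into a domain is prime,
whence `isPrime_span_X_image`. -/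
theorem killVars_eq_zero_iff {A : Set V} {p : MvPolynomial V K} :
    killVars K A p = 0 ↔ p ∈ Ideal.span (X '' A) := by
  classical
  constructor
  · intro h
    have heq : (Ideal.Quotient.mkₐ K (Ideal.span (X '' A))).comp (killVars K A) =
        Ideal.Quotient.mkₐ K (Ideal.span (X '' A)) := by
      ext v
      by_cases hv : v ∈ A
      · have : Ideal.Quotient.mk (Ideal.span (X '' A : Set (MvPolynomial V K))) (X v) = 0 :=
          Ideal.Quotient.eq_zero_iff_mem.2 (Ideal.subset_span ⟨v, hv, rfl⟩)
        simp [killVars, hv, this]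
      · simp [killVars, hv]
    have := DFunLike.congr_fun heq p
    simp only [AlgHom.comp_apply, h, map_zero] at this
    exact Ideal.Quotient.eq_zero_iff_mem.1 this.symm
  · intro h
    have hle : Ideal.span (X '' A) ≤ RingHom.ker (killVars K A) := by
      rw [Ideal.span_le]
      rintro _ ⟨v, hv, rfl⟩
      simp [RingHom.mem_ker, killVars, hv]
    exact hle h

theorem isPrime_span_X_image (A : Set V) :
    (Ideal.span (X '' A : Set (MvPolynomial V K))).IsPrime := by
  have : Ideal.span (X '' A) = RingHom.ker (killVars K A) := by
    ext p
    rw [RingHom.mem_ker, killVars_eq_zero_iff]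
  rw [this]
  exact RingHom.ker_isPrime _

theorem SimpleGraph.depthQuotient_edgeIdeal_le_one {A : Set V} (hA : A.Nonempty)
    (hA' : Aᶜ.Nonempty) (h : ∀ u v, G.Adj u v ↔ (u ∈ A ↔ v ∉ A)) :
    depthQuotient (G.edgeIdeal K) ≤ 1 := by
  classical
  set I := G.edgeIdeal K with hI
  set P : Ideal (MvPolynomial V K) := Ideal.span (X '' A) with hP
  set Q : Ideal (MvPolynomial V K) := Ideal.span (X '' Aᶜ) with hQ
  have hPprime : P.IsPrime := isPrime_span_X_image A
  have hQprime : Q.IsPrime := isPrime_span_X_image Aᶜ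
  have hXP {v} (hv : v ∈ A) : X v ∈ P := Ideal.subset_span ⟨v, hv, rfl⟩
  have hXQ {v} (hv : v ∉ A) : X v ∈ Q := Ideal.subset_span ⟨v, hv, rfl⟩
  have hsup : idealOfVars V K = P ⊔ Q := by
    rw [hP, hQ, ← Ideal.span_union, ← Set.image_union, Set.union_compl_self, Set.image_univ]
  have hIP : I ≤ P := by
    rw [hI, SimpleGraph.edgeIdeal, Ideal.span_le]
    rintro _ ⟨u, v, huv, rfl⟩
    rw [h] at huv
    by_cases hu : u ∈ A
    · exact P.mul_mem_right _ (hXP hu)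
    · exact P.mul_mem_left _ (hXP (by tauto))
  have hIQ : I ≤ Q := by
    rw [hI, SimpleGraph.edgeIdeal, Ideal.span_le]
    rintro _ ⟨u, v, huv, rfl⟩
    rw [h] at huv
    by_cases hu : u ∈ A
    · exact Q.mul_mem_left _ (hXQ (by tauto))
    · exact Q.mul_mem_right _ (hXQ hu)
  have hmul {p q} (hp : p ∈ P) (hq : q ∈ Q) : p * q ∈ I := by
    have : P * Q ≤ I := by
      rw [hP, hQ, Ideal.span_mul_span', Ideal.span_le]
      rintro _ ⟨_, ⟨u, hu, rfl⟩, _, ⟨v, hv, rfl⟩, rfl⟩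
      exact Ideal.subset_span ⟨u, v, (h u v).2 (iff_of_true hu hv), rfl⟩
    exact this (Ideal.mul_mem_mul hp hq)
  have hone : (1 : MvPolynomial V K) ∉ P ⊔ Q := fun h1 ↦
    idealOfVars_ne_top ((Ideal.eq_top_iff_one _).2 (hsup ▸ h1))
  have hnot {B : Set V} {v} (hv : v ∉ B) :
      (X v : MvPolynomial V K) ∉ Ideal.span (X '' B) := by
    rw [← killVars_eq_zero_iff]
    simp [killVars, hv]
  obtain ⟨a₀, ha₀⟩ := hA
  obtain ⟨b₀, hb₀⟩ := hA'
  refine depthIn_le_one fun f hf hreg ↦ ?_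
  have hfP : f ∉ P := fun hfP ↦ hnot hb₀ (hIP (hreg _ (hmul hfP (hXQ hb₀))))
  have hfQ : f ∉ Q := fun hfQ ↦ hnot (B := Aᶜ) (by simpa using ha₀)
    (hIQ (hreg (X a₀) (mul_comm f (X a₀) ▸ hmul (hXP ha₀) hfQ)))
  rw [hsup] at hf ⊢
  obtain ⟨p, hp, q, hq, rfl⟩ := Submodule.mem_sup.1 hf
  -- If `p ≡ f * a` modulo `I`, then `a ∈ P` and `1 - a ∈ Q`, so `1 ∈ P ⊔ Q`. For `g = p' + q'`,
  -- both `g * p` and `f * p'` are `p * p'` modulo `I`.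
  refine ⟨p, fun a ha ↦ hone ?_, fun g hg ↦ ?_⟩
  · have haP : a ∈ P := by
      refine (hPprime.mem_or_mem ?_).resolve_left hfP
      simpa using P.sub_mem hp (hIP ha)
    have haQ : 1 - a ∈ Q := by
      refine (hQprime.mem_or_mem (x := p + q) ?_).resolve_left hfQ
      convert Q.add_mem (hIQ ha) hq using 1
      ring
    simpa using Ideal.add_mem _ (Ideal.mem_sup_left haP) (Ideal.mem_sup_right haQ)
  · obtain ⟨p', hp', q', hq', rfl⟩ := Submodule.mem_sup.1 hg
    refine ⟨p', ?_⟩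
    convert I.sub_mem (hmul hp hq') (hmul hp' hq) using 1
    ring

end CompleteBipartite

theorem proposition2p1 {V : Type*} [Finite V] (K : Type*) [Field K] (G : SimpleGraph V)
    (hbip : G.IsBipartite) (hiso : ∀ v : V, ¬ G.IsIsolated v) :
    G.IsCompleteBipartite ↔ depthQuotient (G.edgeIdeal K) = 1 := by
  rw [SimpleGraph.isCompleteBipartite_iff]
  constructor
  · rintro ⟨A, hA, hA', h⟩
    have : Nonempty V := hA.to_type
    exact le_antisymm (SimpleGraph.depthQuotient_edgeIdeal_le_one hA hA' h)
      SimpleGraph.one_le_depthQuotient_edgeIdeal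
  · intro hdepth
    -- Without vertices the ideal of the variables is zero, so the depth would be 0.
    have hV : Nonempty V := by
      by_contra hV
      rw [not_nonempty_iff] at hV
      have hle : depthQuotient (G.edgeIdeal K) ≤ 0 := by
        refine iSup₂_le fun rs ⟨hreg, hmem⟩ ↦ ?_
        match rs with
        | [] => simp
        | f :: rs =>
          have hf : f = 0 := by
            simpa [idealOfVars, Set.range_eq_empty] using hmem f List.mem_cons_self
          subst hf
          have := hreg.nontrivial
          have hz := ((isWeaklyRegular_cons_iff _ _ _).1 hreg.toIsWeaklyRegular).1
          exact absurd hz IsSMulRegular.not_zero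
      simp [hdepth] at hle
    obtain ⟨col⟩ := hbip
    have hedge (v : V) : ∃ w, G.Adj v w := by simpa [SimpleGraph.IsIsolated] using hiso v
    obtain ⟨v₀⟩ := hV
    obtain ⟨w₀, hw₀⟩ := hedge v₀
    have hadj {u v} (huv : G.Adj u v) : col u = 0 ↔ col v ≠ 0 := by
      have := col.valid huv
      lia
    refine ⟨{v | col v = 0}, ?_, ?_, ?_⟩
    · by_cases h0 : col v₀ = 0
      · exact ⟨v₀, h0⟩
      · exact ⟨w₀, (hadj hw₀.symm).2 h0⟩
    · by_cases h0 : col v₀ = 0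
      · exact ⟨w₀, (hadj hw₀).1 h0⟩
      · exact ⟨v₀, h0⟩
    · by_contra! hne
      obtain ⟨a, b, ha, hb, hab⟩ : ∃ a b, col a = 0 ∧ col b ≠ 0 ∧ ¬ G.Adj a b := by
        obtain ⟨u, v, huv⟩ := hne
        simp only [Set.mem_ofPred_eq] at huv
        rcases huv with ⟨huv, h⟩ | ⟨huv, h⟩
        · have := hadj huv
          tauto
        · by_cases hu : col u = 0
          · exact ⟨u, v, hu, h.1 hu, huv⟩
          · exact ⟨v, u, by tauto, hu, fun h ↦ huv h.symm⟩
      have : Nontrivial V := ⟨v₀, w₀, hw₀.ne⟩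
      have h2 : 2 ≤ depthQuotient (G.edgeIdeal K) := by
        refine SimpleGraph.two_le_depthQuotient_edgeIdeal fun k hk ↦ ?_
        -- The class of `a` is independent, and so is that of `b`; the non-edge `ab` joins them.
        have hka (v) : k v = k a := by
          by_cases hv : col v = 0
          · exact hk v a fun h ↦ (hadj h).1 hv ha
          · rw [hk v b fun h ↦ hv ((hadj h).2 hb), hk a b hab]
        exact fun u v ↦ (hka u).trans (hka v).symm
      rw [hdepth] at h2
      exact absurd h2 (by decide)
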